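/- Let $S$ be a finite set and let $\mu:S\times S\to\mathbb{R}_+$ be a directed distance on $S$, i.e. a nonnegative function with $\mu(s,s)=0$ for all $s\in S$ (neither symmetry nor the triangle inequality is assumed). A network $(G,S,c)$ consists of a finite directed graph $G=(V,E)$ (loops and parallel edges allowed) with $S\subseteq V$ and a capacity $c:E\to\mathbb{Z}_{\ge 0}$. The elements of $S$ are called terminals, the other nodes inner nodes. The network is inner Eulerian if at every inner node the total capacity of the leaving edges equals that of the entering edges. An $S$-path is a directed path joining two distinct terminals; a multiflow is a set $\mathcal{P}$ of $S$-paths with a function $\lambda:\mathcal{P}\to\mathbb{R}_+$ such that $\sum\{\lambda(P): P\in\mathcal{P},\ e\in P\}\le c(e)$ for every $e\in E$; its value is $\sum_{P\in\mathcal{P}}\lambda(P)\,\mu(s_P,t_P)$, where $s_P$ and $t_P$ are the first and the last node of $P$. Let $\mathrm{MFP}^*(\mu;G,S,c)$ be the maximum value of a multiflow. Write points of $\mathbb{R}^{S}\times\mathbb{R}^{S}$ as $p=(p^c,p^r)$, with the componentwise order, and put $$D_\infty(p,q)=\max\Big\{\max_{s\in S}\big(q^c(s)-p^c(s)\big)_+,\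 \max_{s\in S}\big(p^r(s)-q^r(s)\big)_+\Big\},$$ $$P_\mu=\{p : p^c(s)+p^r(t)\ge\mu(s,t)\ \text{for all } s,t\in S\},$$ where $a_+=\max\{a,0\}$ and maxima over the empty set are $0$. For $R\subseteq P_\mu$ let $R^+$ be the set of nonnegative points of $R$ and, for $s\in S$, let $R_s=\{p\in R : p^c(s)+p^r(s)=0\}$. Let $T_\mu$ (the directed tight span) be the set of minimal elements of $P_\mu^+$, and $Q_\mu$ the set of minimal elements of $P_\mu$. A set $R\subseteq Q_\mu$ is a section if the projection $R\to Q_\mu/\mathbb{R}(\mathbf{1},-\mathbf{1})$ is bijective. It is balanced if there are no two points $p, q\in R$ such that $p^c(s)<q^c(s)$ for all $s\in S$, or $p^r(s)<q^r(s)$ for all $s\in S$. For $R\subseteq P_\mu^+$ let $\mathrm{FLP}^*(R;G,S,c)$ be the minimum of $$\sum_{e=xy\in E} c(e)\,D_\infty(\rho(x),\rho(y))$$ over all maps $\rho:V\to R$ with $\rho(s)\in R_s$ for every $s\in S$ (here $x$ is the tail and $y$ the head of $e$). Then: (1) For every network $(G,S,c)$, the optima $\mathrm{MFP}^*(\mu;G,S,c)$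 and $\mathrm{FLP}^*(T_\mu;G,S,c)$ are attained, and $$\mathrm{MFP}^*(\mu;G,S,c)=\mathrm{FLP}^*(T_\mu;G,S,c).$$ (2) For every balanced section $R\subseteq Q_\mu^+$ and every inner Eulerian network $(G,S,c)$, the optima $\mathrm{MFP}^*(\mu;G,S,c)$ and $\mathrm{FLP}^*(R;G,S,c)$ are attained, and $$\mathrm{MFP}^*(\mu;G,S,c)=\mathrm{FLP}^*(R;G,S,c).$$ -/

import Mathlib

namespace DirectedMultiflow

/-- A directed distance on `S`: nonnegative, with zero diagonal (no symmetry, no triangle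
inequality). -/
structure IsDirectedDistance {S : Type*} (μ : S → S → ℝ) : Prop where
  nonneg : ∀ s t, 0 ≤ μ s t
  diag : ∀ s, μ s s = 0

/-! ### Networks -/

/-- A network `(G, S, c)`: a directed graph with node set `V` and edge set `E` (loops and parallel
edges are allowed), a set `S` of nodes called terminals (given by an injection into `V`), and
a nonnegative integer edge capacity. -/
structure Network (S V E : Type*) where
  tail : E → V
  head : E → V
  terminal : S ↪ V
  cap : E → ℕ

namespace Network

variable {S V E : Type*}

/-- `N.IsWalk x es y`: the list of edges `es` is a directed walk from `x` to `y`. -/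
def IsWalk (N : Network S V E) : V → List E → V → Prop
  | x, [], y => x = y
  | x, e :: es, y => N.tail e = x ∧ N.IsWalk (N.head e) es y

/-- An `S`-path: a directed path (no node is visited twice) joining distinct terminals.
Inner nodes of the path may be terminals. -/
structure SPath (N : Network S V E) where
  source : S
  target : S
  source_ne_target : source ≠ target
  edges : List E
  isWalk : N.IsWalk (N.terminal source) edges (N.terminal target)
  nodup : (N.terminal source :: edges.map N.head).Nodup

open Classical in
/-- A multiflow: a set `paths` of `S`-paths (there are only finitely many `S`-paths in a finite
graph) with nonnegative flow values satisfying the capacity constraint. -/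
structure Multiflow (N : Network S V E) where
  paths : Finset N.SPath
  flow : N.SPath → ℝ
  flow_nonneg : ∀ P ∈ paths, 0 ≤ flow P
  capacity : ∀ e : E, ∑ P ∈ paths with e ∈ P.edges, flow P ≤ (N.cap e : ℝ)

/-- The `μ`-weighted value of a multiflow. -/
def Multiflow.val {N : Network S V E} (f : N.Multiflow) (μ : S → S → ℝ) : ℝ :=
  ∑ P ∈ f.paths, f.flow P * μ P.source P.target

/-- The set of objective values of the `μ`-weighted maximum multiflow problem. -/
def mfpValues (N : Network S V E) (μ : S → S → ℝ) : Set ℝ :=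
  Set.range fun f : N.Multiflow => f.val μ

open Classical in
/-- The Eulerian condition at a node: leaving capacity equals entering capacity. -/
def EulerianAt [Fintype E] (N : Network S V E) (x : V) : Prop :=
  ∑ e : E with N.tail e = x, N.cap e = ∑ e : E with N.head e = x, N.cap e

/-- Every inner (that is, non-terminal) node fulfills the Eulerian condition. -/
def InnerEulerian [Fintype E] (N : Network S V E) : Prop :=
  ∀ x : V, x ∉ Set.range N.terminal → N.EulerianAt x

end Network

/-! ### The polyhedron, the directed tight span and the fiber of the tropical polytope -/

/-- The space `ℝ^{S^c ∪ S^r}`; a point is `p = (p^c, p^r)`, with the componentwise order. -/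
abbrev Pt (S : Type*) := (S → ℝ) × (S → ℝ)

section

variable {S : Type*}

/-- The polyhedron `P_μ`. -/
def P (μ : S → S → ℝ) : Set (Pt S) :=
  {p | ∀ s t, μ s t ≤ p.1 s + p.2 t}

/-- The set `R^+` of nonnegative points of `R`. -/
def nonnegPart (R : Set (Pt S)) : Set (Pt S) :=
  {p | p ∈ R ∧ 0 ≤ p}

/-- The set `R_s` of points `p` of `R` with `p(s^c) + p(s^r) = 0`. -/
def terminalPart (R : Set (Pt S)) (s : S) : Set (Pt S) :=
  {p | p ∈ R ∧ p.1 s + p.2 s = 0}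

/-- The directed tight span `T_μ`: the minimal elements of `P_μ^+`. -/
def T (μ : S → S → ℝ) : Set (Pt S) :=
  {p | Minimal (fun q => q ∈ nonnegPart (P μ)) p}

/-- The set `Q_μ` of minimal elements of `P_μ`. -/
def Q (μ : S → S → ℝ) : Set (Pt S) :=
  {p | Minimal (fun q => q ∈ P μ) p}

/-- The linearity space `(𝟙, -𝟙)ℝ` of `P_μ`. -/
def lineality (S : Type*) : Submodule ℝ (Pt S) :=
  Submodule.span ℝ {((1 : S → ℝ), (-1 : S → ℝ))}

/-- The tropical polytope: the image of `Q_μ` in the quotient by `(𝟙, -𝟙)ℝ`. -/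
def Qbar (μ : S → S → ℝ) : Set (Pt S ⧸ lineality S) :=
  (lineality S).mkQ '' Q μ

/-- `R ⊆ Q_μ` is a section if the projection `R → Q_μ / (𝟙, -𝟙)ℝ` is bijective. -/
def IsSection (μ : S → S → ℝ) (R : Set (Pt S)) : Prop :=
  R ⊆ Q μ ∧ Set.BijOn (lineality S).mkQ R (Qbar μ)

/-- `R` is balanced if it has no two points `p`, `q` with `p^c < q^c` or `p^r < q^r`, where
`<` means strict inequality in every coordinate. -/
def IsBalanced (R : Set (Pt S)) : Prop :=
  R.Pairwise fun p q => ¬ ((∀ s, p.1 s < q.1 s) ∨ (∀ s, p.2 s < q.2 s))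

variable [Fintype S]

/-- `D_∞^+(p, q) = ‖(q - p)_+‖_∞`. -/
noncomputable def Dplus (p q : S → ℝ) : ℝ := ‖(q - p)⁺‖

/-- The directed metric `D_∞` on `ℝ^{S^c ∪ S^r}`. -/
noncomputable def D (p q : Pt S) : ℝ := max (Dplus p.1 q.1) (Dplus q.2 p.2)

end

/-! ### The facility location problem -/

namespace Network

variable {S V E : Type*}

/-- Feasible maps of the facility location problem on `R`. -/
def FLPFeasible (N : Network S V E) (R : Set (Pt S)) (ρ : V → Pt S) : Prop :=
  (∀ x, ρ x ∈ R) ∧ ∀ s, ρ (N.terminal s) ∈ terminalPart R s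

/-- The objective function of the facility location problem. -/
noncomputable def flpCost [Fintype S] [Fintype E] (N : Network S V E) (ρ : V → Pt S) : ℝ :=
  ∑ e : E, (N.cap e : ℝ) * D (ρ (N.tail e)) (ρ (N.head e))

/-- The set of objective values of the facility location problem on `R`. -/
def flpValues [Fintype S] [Fintype E] (N : Network S V E) (R : Set (Pt S)) : Set ℝ :=
  N.flpCost '' {ρ | N.FLPFeasible R ρ}

/-- The multiflow problem and the facility location problem on `R` both attain their optima
(maximum and minimum respectively), and the optimal values are equal. -/
def StrongDuality [Fintype S] [Fintype E] (N : Network S V E) (μ : S → S → ℝ)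
    (R : Set (Pt S)) : Prop :=
  ∃ v : ℝ, IsGreatest (N.mfpValues μ) v ∧ IsLeast (N.flpValues R) v

end Network

end DirectedMultiflow

universe u v w

/-!
Weak duality is telescoping along an `S`-path. For the converse, linear programming duality gives
an optimal multiflow `f` and edge lengths `l` for which every `S`-path from `s` to `t` has length at
least `μ s t` and `∑ e, c e * l e` is the value of `f`. Sending a node to the vector of its
`l`-distances from the terminals, and then conjugating twice with respect to `μ`, yields a map `ρ`
into `T_μ`, or into `Q_μ` if negative coordinates are allowed, under which no edge becomes longer
than `l`. In `T_μ` this proves duality.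

Given a section `R`, shift `ρ x ∈ Q_μ` by `α x • (𝟙, -𝟙)` into `R`. In a balanced set the positive
parts in the definition of `D_∞` are inactive, so the shifts lengthen an edge `e` by at most
`α (head e) - α (tail e)`. Since `α` vanishes at the terminals, the capacity-weighted sum of these
changes is zero when all inner nodes are Eulerian.
-/

namespace DirectedMultiflow

section LinearProgramming

open Matrix

variable {𝕜 : Type*} [Field 𝕜] [LinearOrder 𝕜] [IsStrictOrderedRing 𝕜]

-- Farkas' lemma, by Bartl's induction on the number of constraints.
theorem mem_hull_image_of_forall_nonpos {X ι : Type*} [AddCommGroup X] [Module 𝕜 X] (s : Finset ι)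
    (A : ι → X →ₗ[𝕜] 𝕜) (γ : X →ₗ[𝕜] 𝕜)
    (h : ∀ x, (∀ i ∈ s, A i x ≤ 0) → γ x ≤ 0) : γ ∈ PointedCone.hull 𝕜 (A '' s) := by
  induction s using Finset.cons_induction generalizing A γ with
  | empty =>
    have hγ : ∀ x, γ x ≤ 0 := fun x => h x (by simp)
    have : γ = 0 := LinearMap.ext fun x => (hγ x).antisymm (by simpa using hγ (-x))
    exact this ▸ zero_mem _
  | cons j s hj ih =>
    have hmono : A '' s ⊆ A '' (Finset.cons j s hj) :=
      Set.image_mono (Finset.coe_subset.2 (Finset.subset_cons hj))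
    by_cases hs : ∀ x, (∀ i ∈ s, A i x ≤ 0) → γ x ≤ 0
    · exact Submodule.span_mono hmono (ih A γ hs)
    push Not at hs
    obtain ⟨x₀, hx₀, hγ⟩ := hs
    have hj₀ : 0 < A j x₀ := by
      by_contra! hj₀
      exact (h x₀ ((Finset.forall_mem_cons hj _).2 ⟨hj₀, hx₀⟩)).not_gt hγ
    -- The projection along `x₀` onto the kernel of `A j` eliminates the constraint `j`.
    let π : X →ₗ[𝕜] X := LinearMap.id - (A j).smulRight ((A j x₀)⁻¹ • x₀)
    have hπ (B : X →ₗ[𝕜] 𝕜) : B ∘ₗ π = B + -((A j x₀)⁻¹ * B x₀) • A j := by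
      ext x
      simp [π, mul_comm, sub_eq_add_neg]
    have hAj : A j ∈ PointedCone.hull 𝕜 (A '' (Finset.cons j s hj)) :=
      Submodule.subset_span ⟨j, Finset.mem_cons_self j s, rfl⟩
    have hAπ : γ ∘ₗ π ∈ PointedCone.hull 𝕜 (A '' (Finset.cons j s hj)) := by
      refine Submodule.span_le.2 ?_ (ih (fun i => A i ∘ₗ π) (γ ∘ₗ π) fun x hx =>
        h (π x) ((Finset.forall_mem_cons hj _).2 ⟨?_, hx⟩))
      · rintro _ ⟨i, hi, rfl⟩
        have hcoef : 0 ≤ -((A j x₀)⁻¹ * A i x₀) := by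
          rw [← mul_neg]
          exact mul_nonneg (inv_nonneg.2 hj₀.le) (neg_nonneg.2 (hx₀ i hi))
        simp only [SetLike.mem_coe, hπ]
        exact add_mem (Submodule.subset_span (hmono ⟨i, hi, rfl⟩))
          (PointedCone.smul_mem _ hcoef hAj)
      · have : (A j ∘ₗ π) x = 0 := by simp [hπ, hj₀.ne']
        exact this.le
    have hγπ : γ = γ ∘ₗ π + ((A j x₀)⁻¹ * γ x₀) • A j := by
      rw [hπ]
      module
    exact hγπ ▸ add_mem hAπ
      (PointedCone.smul_mem _ (mul_nonneg (inv_nonneg.2 hj₀.le) hγ.le) hAj)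

variable {m n : Type*} [Fintype m] [Fintype n]

theorem exists_nonneg_mulVec_le_of_forall (A : Matrix m n 𝕜) (b : m → 𝕜)
    (h : ∀ u, 0 ≤ u → 0 ≤ u ᵥ* A → 0 ≤ u ⬝ᵥ b) : ∃ z, 0 ≤ z ∧ A *ᵥ z ≤ b := by
  classical
  have hb := mem_hull_image_of_forall_nonpos Finset.univ
    (Sum.elim (fun j => -(LinearMap.proj j ∘ₗ A.vecMulLinear)) fun i => -LinearMap.proj i)
    (-Fintype.linearCombination 𝕜 b) fun u hu => by
      simp only [Finset.mem_univ, forall_const, Sum.forall, Sum.elim_inl, Sum.elim_inr,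
        LinearMap.neg_apply, neg_nonpos] at hu ⊢
      exact h u hu.2 hu.1
  rw [Finset.coe_univ, Set.image_univ] at hb
  obtain ⟨w, hw⟩ := (Submodule.mem_span_range_iff_exists_fun _).1 hb
  refine ⟨fun j => w (Sum.inl j), fun j => (w _).2, fun i => ?_⟩
  have hi := LinearMap.congr_fun hw (Pi.single i 1)
  simp only [Fintype.sum_sum_type, Sum.elim_inl, Sum.elim_inr, LinearMap.add_apply,
    LinearMap.sum_apply, ← Nonneg.coe_smul, LinearMap.smul_apply, LinearMap.neg_apply,
    LinearMap.comp_apply, vecMulLinear_apply, single_one_vecMul, LinearMap.proj_apply, row_apply,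
    Pi.single_apply, Fintype.linearCombination_apply_single, smul_eq_mul, mul_neg, mul_ite,
    mul_one, mul_zero, one_mul, Finset.sum_neg_distrib, Finset.sum_ite_eq', Finset.mem_univ,
    if_true] at hi
  have hcomm : (A *ᵥ fun j => (w (Sum.inl j) : 𝕜)) i = ∑ j, w (Sum.inl j) * A i j :=
    dotProduct_comm _ _
  have hslack : 0 ≤ (w (Sum.inr i) : 𝕜) := (w _).2
  linarith

/-- Feasible solutions of the linear program `max {c ⬝ᵥ x | A *ᵥ x ≤ b, 0 ≤ x}`. -/
def IsPrimalFeasible (A : Matrix m n 𝕜) (b : m → 𝕜) (x : n → 𝕜) : Prop :=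
  0 ≤ x ∧ A *ᵥ x ≤ b

/-- Feasible solutions of the dual program `min {y ⬝ᵥ b | c ≤ y ᵥ* A, 0 ≤ y}`. -/
def IsDualFeasible (A : Matrix m n 𝕜) (c : n → 𝕜) (y : m → 𝕜) : Prop :=
  0 ≤ y ∧ c ≤ y ᵥ* A

variable {A : Matrix m n 𝕜} {b : m → 𝕜} {c : n → 𝕜}

theorem IsPrimalFeasible.dotProduct_le {x : n → 𝕜} {y : m → 𝕜} (hx : IsPrimalFeasible A b x)
    (hy : IsDualFeasible A c y) : c ⬝ᵥ x ≤ y ⬝ᵥ b :=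
  calc c ⬝ᵥ x ≤ y ᵥ* A ⬝ᵥ x := dotProduct_le_dotProduct_of_nonneg_right hy.2 hx.1
    _ = y ⬝ᵥ A *ᵥ x := (dotProduct_mulVec _ _ _).symm
    _ ≤ y ⬝ᵥ b := dotProduct_le_dotProduct_of_nonneg_left hx.2 hy.1

theorem IsPrimalFeasible.dotProduct_le_of_smul {x₀ x : n → 𝕜} {y₀ y : m → 𝕜} {t : 𝕜}
    (hx₀ : IsPrimalFeasible A b x₀) (hy₀ : IsDualFeasible A c y₀) (ht : 0 ≤ t)
    (hx : IsPrimalFeasible A (t • b) x) (hy : IsDualFeasible A (t • c) y) : c ⬝ᵥ x ≤ y ⬝ᵥ b := by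
  rcases ht.eq_or_lt with rfl | ht
  · rw [zero_smul] at hx hy
    calc c ⬝ᵥ x ≤ y₀ ⬝ᵥ 0 := hx.dotProduct_le hy₀
      _ = 0 ⬝ᵥ x₀ := by rw [dotProduct_zero, zero_dotProduct]
      _ ≤ y ⬝ᵥ b := hx₀.dotProduct_le hy
  · have := hx.dotProduct_le hy
    rw [smul_dotProduct, dotProduct_smul, smul_eq_mul, smul_eq_mul] at this
    exact le_of_mul_le_mul_left this ht

theorem exists_dotProduct_eq_of_feasible {x₀ : n → 𝕜} {y₀ : m → 𝕜}
    (hx₀ : IsPrimalFeasible A b x₀) (hy₀ : IsDualFeasible A c y₀) :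
    ∃ x y, IsPrimalFeasible A b x ∧ IsDualFeasible A c y ∧ c ⬝ᵥ x = y ⬝ᵥ b := by
  have vecMul_row (u : Unit → 𝕜) (v : n ⊕ m → 𝕜) : u ᵥ* replicateRow Unit v = u () • v := by
    ext; simp [vecMul, dotProduct]
  have row_mulVec (v w : n ⊕ m → 𝕜) : replicateRow Unit v *ᵥ w = fun _ => v ⬝ᵥ w := rfl
  -- The system `A *ᵥ x ≤ b`, `c ≤ y ᵥ* A`, `y ⬝ᵥ b ≤ c ⬝ᵥ x` in the unknown `(x, y)`.
  obtain ⟨z, hz, hBz⟩ := exists_nonneg_mulVec_le_of_forall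
    (fromRows (fromBlocks A 0 0 (-Aᵀ)) (replicateRow Unit (Sum.elim (-c) b)))
    (Sum.elim (Sum.elim b (-c)) 0) fun u hu huB => by
      obtain ⟨v, t, rfl⟩ : ∃ v t, u = Sum.elim v t := ⟨_, _, (Sum.elim_comp_inl_inr u).symm⟩
      obtain ⟨y, x, rfl⟩ : ∃ y x, v = Sum.elim y x := ⟨_, _, (Sum.elim_comp_inl_inr v).symm⟩
      simp only [Pi.le_def, Pi.zero_apply, Sum.forall, Sum.elim_inl, Sum.elim_inr, vecMul_fromRows,
        Sum.elim_comp_inl, vecMul_fromBlocks, Sum.elim_comp_inr, vecMul_zero, add_zero, vecMul_neg,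
        vecMul_transpose, zero_add, vecMul_row, Pi.add_apply, Pi.smul_apply, smul_eq_mul,
        Pi.neg_apply, mul_neg, le_add_neg_iff_add_le, le_neg_add_iff_add_le,
        sumElim_dotProduct_sumElim, dotProduct_neg, dotProduct_zero] at hu huB ⊢
      rw [dotProduct_comm x]
      exact hx₀.dotProduct_le_of_smul hy₀ (hu.2 ()) ⟨hu.1.2, huB.2⟩ ⟨hu.1.1, huB.1⟩
  obtain ⟨x, y, rfl⟩ : ∃ x y, z = Sum.elim x y := ⟨_, _, (Sum.elim_comp_inl_inr z).symm⟩
  simp only [Pi.le_def, Pi.zero_apply, Sum.forall, Sum.elim_inl, Sum.elim_inr, fromRows_mulVec,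
    fromBlocks_mulVec, Sum.elim_comp_inl, Sum.elim_comp_inr, zero_mulVec, add_zero, neg_mulVec,
    mulVec_transpose, zero_add, row_mulVec, sumElim_dotProduct_sumElim, neg_dotProduct,
    Pi.neg_apply, neg_le_neg_iff, neg_add_le_iff_le_add, forall_const] at hz hBz
  have hx : IsPrimalFeasible A b x := ⟨hz.1, hBz.1.1⟩
  have hy : IsDualFeasible A c y := ⟨hz.2, hBz.1.2⟩
  exact ⟨x, y, hx, hy, (hx.dotProduct_le hy).antisymm ((dotProduct_comm y b).trans_le hBz.2)⟩

end LinearProgramming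

namespace Network

variable {S V E : Type*} {N : Network S V E} {μ : S → S → ℝ} {l : E → ℝ}

theorem IsWalk.concat {es : List E} {x : V} {e : E} (h : N.IsWalk x es (N.tail e)) :
    N.IsWalk x (es ++ [e]) (N.head e) := by
  induction es generalizing x with
  | nil => exact ⟨h.symm, rfl⟩
  | cons a es ih => exact ⟨h.1, ih h.2⟩

theorem IsWalk.sub_le_sum {π : V → ℝ} (hπ : ∀ e, π (N.head e) - π (N.tail e) ≤ l e)
    {es : List E} {x y : V} (h : N.IsWalk x es y) : π y - π x ≤ (es.map l).sum := by
  induction es generalizing x with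
  | nil =>
    obtain rfl : x = y := h
    simp
  | cons e es ih =>
    obtain ⟨rfl, h⟩ := h
    rw [List.map_cons, List.sum_cons]
    linarith [ih h, hπ e]

theorem IsWalk.exists_nodup_sublist_of_mem {es : List E} {x y z : V} (h : N.IsWalk z es y)
    (hn : (z :: es.map N.head).Nodup) (hx : x ∈ z :: es.map N.head) :
    ∃ es', N.IsWalk x es' y ∧ (x :: es'.map N.head).Nodup ∧ es'.Sublist es := by
  induction es generalizing z with
  | nil =>
    obtain rfl : x = z := List.mem_singleton.1 hx
    exact ⟨[], h, hn, List.Sublist.refl _⟩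
  | cons e es ih =>
    rcases List.mem_cons.1 hx with rfl | hx
    · exact ⟨e :: es, h, hn, List.Sublist.refl _⟩
    · obtain ⟨es', hwalk, hnodup, hsub⟩ := ih h.2 (List.nodup_cons.1 hn).2 hx
      exact ⟨es', hwalk, hnodup, hsub.cons _⟩

theorem IsWalk.exists_nodup_sublist {es : List E} {x y : V} (h : N.IsWalk x es y) :
    ∃ es', N.IsWalk x es' y ∧ (x :: es'.map N.head).Nodup ∧ es'.Sublist es := by
  induction es generalizing x with
  | nil => exact ⟨[], h, List.nodup_singleton x, List.Sublist.refl _⟩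
  | cons e es ih =>
    obtain ⟨es', hwalk, hnodup, hsub⟩ := ih h.2
    by_cases hx : x ∈ N.head e :: es'.map N.head
    · obtain ⟨es'', hwalk', hnodup', hsub'⟩ := hwalk.exists_nodup_sublist_of_mem hnodup hx
      exact ⟨es'', hwalk', hnodup', (hsub'.trans hsub).cons _⟩
    · exact ⟨e :: es', ⟨h.1, hwalk⟩, List.nodup_cons.2 ⟨hx, hnodup⟩, hsub.cons_cons _⟩

theorem sum_map_nonneg (hl : 0 ≤ l) (es : List E) : 0 ≤ (es.map l).sum :=
  List.sum_nonneg (List.forall_mem_map.2 fun e _ => hl e)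

theorem IsWalk.le_sum_of_forall_sPath (hμ : ∀ s, μ s s ≤ 0) (hl : 0 ≤ l)
    (h : ∀ W : N.SPath, μ W.source W.target ≤ (W.edges.map l).sum) {s t : S} {es : List E}
    (hes : N.IsWalk (N.terminal s) es (N.terminal t)) : μ s t ≤ (es.map l).sum := by
  by_cases hst : s = t
  · exact hst ▸ (hμ s).trans (sum_map_nonneg hl es)
  · obtain ⟨es', hwalk, hnodup, hsub⟩ := hes.exists_nodup_sublist
    exact (h ⟨s, t, hst, es', hwalk, hnodup⟩).trans <|
      (hsub.map l).sum_le_sum (List.forall_mem_map.2 fun e _ => hl e)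

theorem SPath.nodup_edges (W : N.SPath) : W.edges.Nodup :=
  List.Nodup.of_map _ (List.nodup_cons.1 W.nodup).2

theorem SPath.edges_ne_nil (W : N.SPath) : W.edges ≠ [] := by
  intro h
  have hwalk := W.isWalk
  rw [h] at hwalk
  exact W.source_ne_target (N.terminal.injective hwalk)

instance finite_sPath [Finite S] [Finite E] : Finite N.SPath := by
  classical
  have := Fintype.ofFinite E
  refine Finite.of_injective (β := S × S × {es : List E // es.Nodup})
    (fun W => (W.source, W.target, ⟨W.edges, W.nodup_edges⟩)) ?_
  rintro ⟨s, t, _, es, _, _⟩ ⟨s', t', _, es', _, _⟩ h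
  simp only [Prod.mk.injEq, Subtype.mk.injEq] at h
  obtain ⟨rfl, rfl, rfl⟩ := h
  rfl

open Classical in
theorem SPath.sum_edges [Fintype E] (W : N.SPath) (l : E → ℝ) :
    (W.edges.map l).sum = ∑ e with e ∈ W.edges, l e := by
  rw [← List.sum_toFinset l W.nodup_edges]
  congr 1
  ext e
  simp

open Classical in
theorem Multiflow.val_le_sum [Fintype E] (f : N.Multiflow) (hl : 0 ≤ l)
    (h : ∀ W ∈ f.paths, μ W.source W.target ≤ (W.edges.map l).sum) :
    f.val μ ≤ ∑ e, (N.cap e : ℝ) * l e := by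
  calc f.val μ ≤ ∑ W ∈ f.paths, f.flow W * (W.edges.map l).sum :=
        Finset.sum_le_sum fun W hW => mul_le_mul_of_nonneg_left (h W hW) (f.flow_nonneg W hW)
    _ = ∑ W ∈ f.paths, ∑ e, if e ∈ W.edges then f.flow W * l e else 0 :=
        Finset.sum_congr rfl fun W _ => by rw [W.sum_edges, Finset.mul_sum, Finset.sum_filter]
    _ = ∑ e, (∑ W ∈ f.paths with e ∈ W.edges, f.flow W) * l e := by
        rw [Finset.sum_comm]
        exact Finset.sum_congr rfl fun e _ => by rw [Finset.sum_mul, Finset.sum_filter]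
    _ ≤ ∑ e, (N.cap e : ℝ) * l e :=
        Finset.sum_le_sum fun e _ => mul_le_mul_of_nonneg_right (f.capacity e) (hl e)

open Classical in
/-- The incidence matrix of edges and `S`-paths. -/
noncomputable def pathIncidence (N : Network S V E) : Matrix E N.SPath ℝ :=
  Matrix.of fun e W => if e ∈ W.edges then 1 else 0

open Matrix in
theorem vecMul_pathIncidence [Fintype E] (l : E → ℝ) (W : N.SPath) :
    (l ᵥ* N.pathIncidence) W = (W.edges.map l).sum := by
  simp only [vecMul, dotProduct, pathIncidence, of_apply, mul_ite, mul_one, mul_zero, W.sum_edges,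
    Finset.sum_filter]

open Classical Matrix in
theorem pathIncidence_mulVec [Fintype N.SPath] (x : N.SPath → ℝ) (e : E) :
    (N.pathIncidence *ᵥ x) e = ∑ W with e ∈ W.edges, x W := by
  simp only [mulVec, dotProduct, pathIncidence, of_apply, ite_mul, one_mul, zero_mul,
    Finset.sum_filter]

theorem exists_nonneg_forall_le [Finite S] (μ : S → S → ℝ) : ∃ M, 0 ≤ M ∧ ∀ s t, μ s t ≤ M := by
  obtain ⟨M, hM⟩ := (Set.finite_range μ.uncurry).bddAbove
  exact ⟨max 0 M, le_max_left _ _, fun s t => le_max_of_le_right (hM ⟨(s, t), rfl⟩)⟩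

theorem exists_multiflow_val_eq_sum [Finite S] [Fintype E] (N : Network S V E) (μ : S → S → ℝ) :
    ∃ (f : N.Multiflow) (l : E → ℝ), 0 ≤ l ∧
      (∀ W : N.SPath, μ W.source W.target ≤ (W.edges.map l).sum) ∧
      f.val μ = ∑ e, (N.cap e : ℝ) * l e := by
  have := Fintype.ofFinite N.SPath
  obtain ⟨M, hM₀, hM⟩ := exists_nonneg_forall_le μ
  have hzero : IsPrimalFeasible N.pathIncidence (fun e => (N.cap e : ℝ)) 0 :=
    ⟨le_rfl, fun e => by simp⟩
  have hconst : IsDualFeasible N.pathIncidence (fun W => μ W.source W.target) fun _ => M := by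
    refine ⟨fun _ => hM₀, fun W => ?_⟩
    obtain ⟨e, he⟩ := List.exists_mem_of_ne_nil _ W.edges_ne_nil
    rw [vecMul_pathIncidence]
    exact (hM _ _).trans <| List.single_le_sum (List.forall_mem_map.2 fun _ _ => hM₀) _
      (List.mem_map_of_mem he)
  obtain ⟨x, l, hx, hl, h⟩ := exists_dotProduct_eq_of_feasible hzero hconst
  refine ⟨⟨Finset.univ, x, fun W _ => hx.1 W, fun e => ?_⟩, l, hl.1, fun W => ?_, ?_⟩
  · exact (pathIncidence_mulVec x e).symm.trans_le (hx.2 e)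
  · exact (hl.2 W).trans_eq (vecMul_pathIncidence l W)
  · simpa only [Multiflow.val, dotProduct, mul_comm] using h

/-- The `l`-distance from `u` to `x`, truncated from above at `M` so that it is finite also for
nodes that are not reachable from `u`. -/
noncomputable def truncDist (N : Network S V E) (l : E → ℝ) (M : ℝ) (u x : V) : ℝ :=
  sInf (insert M {a | ∃ es, N.IsWalk u es x ∧ (es.map l).sum = a})

theorem le_truncDist_iff (hl : 0 ≤ l) {M a : ℝ} {u x : V} :
    a ≤ N.truncDist l M u x ↔ a ≤ M ∧ ∀ es, N.IsWalk u es x → a ≤ (es.map l).sum := by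
  have hbdd : BddBelow {a | ∃ es, N.IsWalk u es x ∧ (es.map l).sum = a} :=
    ⟨0, by rintro _ ⟨es, -, rfl⟩; exact sum_map_nonneg hl es⟩
  rw [truncDist, le_csInf_iff (hbdd.insert M) (Set.insert_nonempty _ _), Set.forall_mem_insert]
  simp only [Set.mem_ofPred_eq, forall_exists_index, and_imp, forall_apply_eq_imp_iff₂]

theorem truncDist_self_nonpos (hl : 0 ≤ l) (M : ℝ) (u : V) : N.truncDist l M u u ≤ 0 :=
  ((le_truncDist_iff hl).1 le_rfl).2 [] rfl

theorem truncDist_head_le (hl : 0 ≤ l) (M : ℝ) (u : V) (e : E) :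
    N.truncDist l M u (N.head e) ≤ N.truncDist l M u (N.tail e) + l e := by
  obtain ⟨hM, hwalk⟩ := (le_truncDist_iff hl).1 (le_refl (N.truncDist l M u (N.head e)))
  rw [← sub_le_iff_le_add, le_truncDist_iff hl]
  refine ⟨(sub_le_self _ (hl e)).trans hM, fun es hes => sub_le_iff_le_add.2 ?_⟩
  simpa using hwalk _ hes.concat

end Network

section Geometry

variable {S : Type*}

theorem Dplus_le_iff [Fintype S] {p q : S → ℝ} {a : ℝ} (ha : 0 ≤ a) :
    Dplus p q ≤ a ↔ ∀ s, q s - p s ≤ a := by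
  rw [Dplus, pi_norm_le_iff_of_nonneg ha]
  refine forall_congr' fun s => ?_
  rw [Pi.posPart_apply, Real.norm_of_nonneg (posPart_nonneg _), posPart_def, Pi.sub_apply]
  exact sup_le_iff.trans (and_iff_left ha)

theorem D_le_iff [Fintype S] {p q : Pt S} {a : ℝ} (ha : 0 ≤ a) :
    D p q ≤ a ↔ (∀ s, q.1 s - p.1 s ≤ a) ∧ ∀ s, p.2 s - q.2 s ≤ a := by
  rw [D, max_le_iff, Dplus_le_iff ha, Dplus_le_iff ha]

theorem D_nonneg [Fintype S] (p q : Pt S) : 0 ≤ D p q := le_max_of_le_left (norm_nonneg _)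

theorem eq_zero_of_mem_terminalPart {R : Set (Pt S)} {s : S} {p : Pt S} (h₀ : 0 ≤ p)
    (hp : p ∈ terminalPart R s) : p.1 s = 0 ∧ p.2 s = 0 :=
  (add_eq_zero_iff_of_nonneg (h₀.1 s) (h₀.2 s)).1 hp.2

/-- The points of `R` all of whose coordinates are at least `b`. The floors `b = 0` and `b = ⊥`
give `R^+` and `R`, so that `T_μ` and `Q_μ` can be treated together. -/
def floorPart (b : WithBot ℝ) (R : Set (Pt S)) : Set (Pt S) :=
  {p | p ∈ R ∧ ∀ s, b ≤ p.1 s ∧ b ≤ p.2 s}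

theorem floorPart_zero (R : Set (Pt S)) : floorPart 0 R = nonnegPart R := by
  ext p
  simp only [floorPart, nonnegPart, Prod.le_def, Pi.le_def, Set.mem_ofPred_eq, forall_and]
  norm_cast

theorem floorPart_bot (R : Set (Pt S)) : floorPart ⊥ R = R := by
  simp [floorPart]

theorem minimal_mem_floorPart_zero_iff {μ : S → S → ℝ} {p : Pt S} :
    Minimal (fun q => q ∈ floorPart 0 (P μ)) p ↔ p ∈ T μ := by
  rw [floorPart_zero, T, Set.mem_ofPred_eq]

theorem minimal_mem_floorPart_bot_iff {μ : S → S → ℝ} {p : Pt S} :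
    Minimal (fun q => q ∈ floorPart ⊥ (P μ)) p ↔ p ∈ Q μ := by
  rw [floorPart_bot, Q, Set.mem_ofPred_eq]

/-- The `μ`-conjugate `t ↦ max_s (μ(s, t) - f(s))` of `f`, raised to the floor `b`.
The value of `unbotD` at `⊥` is irrelevant, as the maximum is never `⊥`. -/
noncomputable def conjugate (b : WithBot ℝ) (μ : S → S → ℝ) (f : S → ℝ) (t : S) : ℝ :=
  WithBot.unbotD 0 (max b ↑(⨆ s, (μ s t - f s)))

variable {b : WithBot ℝ} {μ : S → S → ℝ} {f f' : S → ℝ}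

theorem conjugate_le_iff [Finite S] {t : S} {a : ℝ} :
    conjugate b μ f t ≤ a ↔ b ≤ a ∧ ∀ s, μ s t ≤ f s + a := by
  have : Nonempty S := ⟨t⟩
  have hne : max b ↑(⨆ s, (μ s t - f s)) ≠ ⊥ := by simp
  rw [conjugate, WithBot.unbotD_le_iff (absurd · hne), max_le_iff, WithBot.coe_le_coe,
    ciSup_le_iff (Set.finite_range _).bddAbove]
  simp only [sub_le_iff_le_add']

theorem floor_le_conjugate [Finite S] (b : WithBot ℝ) (μ : S → S → ℝ) (f : S → ℝ) (t : S) :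
    b ≤ conjugate b μ f t :=
  (conjugate_le_iff.1 le_rfl).1

theorem le_add_conjugate [Finite S] (b : WithBot ℝ) (μ : S → S → ℝ) (f : S → ℝ) (s t : S) :
    μ s t ≤ f s + conjugate b μ f t :=
  (conjugate_le_iff.1 le_rfl).2 s

theorem conjugate_conjugate_le [Finite S] (hf : ∀ s, b ≤ f s) (s : S) :
    conjugate b (flip μ) (conjugate b μ f) s ≤ f s :=
  conjugate_le_iff.2 ⟨hf s, fun t => (le_add_conjugate b μ f s t).trans_eq (add_comm _ _)⟩

theorem conjugate_le_conjugate_add [Finite S] {a : ℝ} (ha : 0 ≤ a) (h : ∀ s, f' s ≤ f s + a)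
    (t : S) : conjugate b μ f t ≤ conjugate b μ f' t + a := by
  refine conjugate_le_iff.2 ⟨(floor_le_conjugate b μ f' t).trans ?_, fun s => ?_⟩
  · exact WithBot.coe_le_coe.2 (le_add_of_nonneg_right ha)
  · linarith [h s, le_add_conjugate b μ f' s t]

/-- The point of `floorPart b (P μ)` obtained from `f` by double conjugation. This is a retraction
onto the minimal points of `floorPart b (P μ)` that does not increase distances. -/
noncomputable def tightPoint (b : WithBot ℝ) (μ : S → S → ℝ) (f : S → ℝ) : Pt S :=
  (conjugate b (flip μ) (conjugate b μ f), conjugate b μ f)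

theorem tightPoint_mem_floorPart [Finite S] (b : WithBot ℝ) (μ : S → S → ℝ) (f : S → ℝ) :
    tightPoint b μ f ∈ floorPart b (P μ) := by
  refine ⟨fun s t => ?_, fun s => ⟨floor_le_conjugate _ _ _ s, floor_le_conjugate _ _ _ s⟩⟩
  exact (le_add_conjugate b (flip μ) (conjugate b μ f) t s).trans_eq (add_comm _ _)

theorem minimal_tightPoint [Finite S] (hf : ∀ s, b ≤ f s) :
    Minimal (fun p => p ∈ floorPart b (P μ)) (tightPoint b μ f) := by
  refine ⟨tightPoint_mem_floorPart b μ f, fun q ⟨hq, hbq⟩ hle => ⟨fun s => ?_, fun t => ?_⟩⟩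
  · refine conjugate_le_iff.2 ⟨(hbq s).1, fun t => ((hq s t).trans_eq (add_comm _ _)).trans ?_⟩
    exact add_le_add_left (hle.2 t) _
  · refine conjugate_le_iff.2 ⟨(hbq t).2, fun s => (hq s t).trans ?_⟩
    exact add_le_add_left ((hle.1 s).trans (conjugate_conjugate_le hf s)) _

theorem D_tightPoint_le [Fintype S] : D (tightPoint b μ f) (tightPoint b μ f') ≤ Dplus f f' := by
  have ha : 0 ≤ Dplus f f' := norm_nonneg _
  have hf (s : S) : f' s ≤ f s + Dplus f f' :=
    sub_le_iff_le_add'.1 ((Dplus_le_iff ha).1 le_rfl s)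
  have hconj := conjugate_le_conjugate_add (b := b) (μ := μ) ha hf
  exact (D_le_iff ha).2 ⟨fun s => sub_le_iff_le_add'.2 (conjugate_le_conjugate_add ha hconj s),
    fun s => sub_le_iff_le_add'.2 (hconj s)⟩

theorem IsBalanced.D_le [Fintype S] [Nonempty S] {R : Set (Pt S)} (hR : IsBalanced R) {p q : Pt S}
    {a : ℝ} (hp : p ∈ R) (hq : q ∈ R) (h₁ : ∀ s, q.1 s - p.1 s ≤ a)
    (h₂ : ∀ s, p.2 s - q.2 s ≤ a) : D p q ≤ a := by
  obtain ⟨s, hs⟩ : ∃ s, p.1 s ≤ q.1 s := by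
    by_contra! hlt
    exact hR hq hp (fun hqp => (hlt (Classical.arbitrary S)).ne (by rw [hqp])) (Or.inl hlt)
  exact (D_le_iff ((sub_nonneg.2 hs).trans (h₁ s))).2 ⟨h₁, h₂⟩

end Geometry

theorem exists_mem_eq_add_of_surjOn {S : Type*} {μ : S → S → ℝ} {R : Set (Pt S)}
    (hR : Set.SurjOn (lineality S).mkQ R (Qbar μ)) {p : Pt S} (hp : p ∈ Q μ) :
    ∃ a : ℝ, ∃ q ∈ R, ∀ s, q.1 s = p.1 s + a ∧ q.2 s = p.2 s - a := by
  obtain ⟨q, hq, hqp⟩ := hR ⟨p, hp, rfl⟩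
  obtain ⟨a, ha⟩ := Submodule.mem_span_singleton.1 ((Submodule.Quotient.eq (lineality S)).1 hqp)
  obtain rfl : q = p + a • (1, -1) := by rw [ha, add_sub_cancel]
  exact ⟨a, _, hq, fun s => by simp [sub_eq_add_neg]⟩

namespace Network

variable {S V E : Type*} {N : Network S V E} {μ : S → S → ℝ} {R : Set (Pt S)}

theorem exists_minimal_map_D_le [Fintype S] {b : WithBot ℝ} (hb : b ≤ 0) (hμ : ∀ s, μ s s ≤ 0)
    {l : E → ℝ} (hl : 0 ≤ l) (h : ∀ W : N.SPath, μ W.source W.target ≤ (W.edges.map l).sum) :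
    ∃ ρ : V → Pt S, (∀ x, Minimal (fun p => p ∈ floorPart b (P μ)) (ρ x)) ∧
      (∀ s, (ρ (N.terminal s)).1 s ≤ 0 ∧ (ρ (N.terminal s)).2 s ≤ 0) ∧
      ∀ e, D (ρ (N.tail e)) (ρ (N.head e)) ≤ l e := by
  obtain ⟨M, hM₀, hM⟩ := exists_nonneg_forall_le μ
  let dist (x : V) (s : S) : ℝ := N.truncDist l M (N.terminal s) x
  have hdist (x : V) (s : S) : b ≤ dist x s :=
    hb.trans <| WithBot.coe_le_coe.2 <|
      (le_truncDist_iff hl).2 ⟨hM₀, fun es _ => sum_map_nonneg hl es⟩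
  have hμdist (s t : S) : μ s t ≤ dist (N.terminal t) s :=
    (le_truncDist_iff hl).2 ⟨hM s t, fun es hes => hes.le_sum_of_forall_sPath hμ hl h⟩
  refine ⟨fun x => tightPoint b μ (dist x), fun x => minimal_tightPoint (hdist x),
    fun s => ⟨?_, ?_⟩, fun e => D_tightPoint_le.trans ((Dplus_le_iff (hl e)).2 fun s => ?_)⟩
  · exact (conjugate_conjugate_le (hdist _) s).trans (truncDist_self_nonpos hl M _)
  · exact conjugate_le_iff.2 ⟨hb, fun t => (hμdist t s).trans_eq (add_zero _).symm⟩
  · exact sub_le_iff_le_add'.2 (truncDist_head_le hl M (N.terminal s) e)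

open Classical in
theorem InnerEulerian.sum_cap_mul_sub_eq_zero [Fintype E] (hN : N.InnerEulerian) {α : V → ℝ}
    (hα : ∀ s, α (N.terminal s) = 0) :
    ∑ e, (N.cap e : ℝ) * (α (N.head e) - α (N.tail e)) = 0 := by
  let nodes : Finset V := Finset.univ.image N.head ∪ Finset.univ.image N.tail
  have sum_fibers (f : E → V) (hf : ∀ e, f e ∈ nodes) : ∑ e, (N.cap e : ℝ) * α (f e) =
      ∑ x ∈ nodes, ((∑ e with f e = x, N.cap e : ℕ) : ℝ) * α x := by
    rw [← Finset.sum_fiberwise_of_maps_to fun e _ => hf e]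
    refine Finset.sum_congr rfl fun x _ => ?_
    rw [Nat.cast_sum, Finset.sum_mul]
    exact Finset.sum_congr rfl fun e he => by rw [(Finset.mem_filter.1 he).2]
  simp only [mul_sub, Finset.sum_sub_distrib]
  rw [sum_fibers N.head (by simp [nodes]), sum_fibers N.tail (by simp [nodes]), sub_eq_zero]
  refine Finset.sum_congr rfl fun x _ => ?_
  by_cases hx : x ∈ Set.range N.terminal
  · obtain ⟨s, rfl⟩ := hx
    rw [hα, mul_zero, mul_zero]
  · rw [hN x hx]

variable [Fintype S] [Fintype E]

theorem Multiflow.val_le_flpCost (f : N.Multiflow) (hR : R ⊆ nonnegPart (P μ)) {ρ : V → Pt S}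
    (hρ : N.FLPFeasible R ρ) : f.val μ ≤ N.flpCost ρ := by
  refine f.val_le_sum (fun e => D_nonneg _ _) fun W _ => ?_
  have hs := (eq_zero_of_mem_terminalPart (hR (hρ.1 _)).2 (hρ.2 W.source)).1
  have ht := (eq_zero_of_mem_terminalPart (hR (hρ.1 _)).2 (hρ.2 W.target)).2
  calc μ W.source W.target
      ≤ (ρ (N.terminal W.target)).1 W.source + (ρ (N.terminal W.target)).2 W.target :=
        (hR (hρ.1 _)).1 W.source W.target
    _ = (ρ (N.terminal W.target)).1 W.source - (ρ (N.terminal W.source)).1 W.source := by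
        rw [hs, ht, add_zero, sub_zero]
    _ ≤ (W.edges.map fun e => D (ρ (N.tail e)) (ρ (N.head e))).sum :=
        W.isWalk.sub_le_sum (π := fun x => (ρ x).1 W.source)
          fun e => ((D_le_iff (D_nonneg _ _)).1 le_rfl).1 W.source

theorem strongDuality_of_flpCost_le (hR : R ⊆ nonnegPart (P μ)) {ρ : V → Pt S}
    (hρ : N.FLPFeasible R ρ) {f : N.Multiflow} (h : N.flpCost ρ ≤ f.val μ) :
    N.StrongDuality μ R := by
  refine ⟨f.val μ, ⟨⟨f, rfl⟩, ?_⟩, ⟨ρ, hρ, h.antisymm (f.val_le_flpCost hR hρ)⟩, ?_⟩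
  · rintro _ ⟨g, rfl⟩
    exact (g.val_le_flpCost hR hρ).trans h
  · rintro _ ⟨ρ', hρ', rfl⟩
    exact f.val_le_flpCost hR hρ'

theorem strongDuality_T (N : Network S V E) (hμ : ∀ s, μ s s ≤ 0) : N.StrongDuality μ (T μ) := by
  obtain ⟨f, l, hl, hlμ, hfl⟩ := exists_multiflow_val_eq_sum N μ
  obtain ⟨ρ, hρ, hρs, hρe⟩ := exists_minimal_map_D_le le_rfl hμ hl hlμ
  have hρT (x : V) : ρ x ∈ T μ := minimal_mem_floorPart_zero_iff.1 (hρ x)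
  have hfeas : N.FLPFeasible (T μ) ρ := ⟨hρT, fun s => ⟨hρT _,
    (add_nonpos (hρs s).1 (hρs s).2).antisymm <|
      add_nonneg ((hρT _).1.2.1 s) ((hρT _).1.2.2 s)⟩⟩
  refine strongDuality_of_flpCost_le (fun p hp => hp.1) hfeas (f := f) (hfl ▸ ?_)
  exact Finset.sum_le_sum fun e _ => mul_le_mul_of_nonneg_left (hρe e) (Nat.cast_nonneg _)

theorem InnerEulerian.strongDuality_of_isBalanced [Nonempty S] (hN : N.InnerEulerian)
    (hμ : ∀ s, μ s s ≤ 0) (hR : R ⊆ nonnegPart (P μ))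
    (hsurj : Set.SurjOn (lineality S).mkQ R (Qbar μ)) (hbal : IsBalanced R) :
    N.StrongDuality μ R := by
  obtain ⟨f, l, hl, hlμ, hfl⟩ := exists_multiflow_val_eq_sum N μ
  obtain ⟨ρ, hρ, hρs, hρe⟩ := exists_minimal_map_D_le bot_le hμ hl hlμ
  have hρQ (x : V) : ρ x ∈ Q μ := minimal_mem_floorPart_bot_iff.1 (hρ x)
  choose α σ hσ hσρ using fun x => exists_mem_eq_add_of_surjOn hsurj (hρQ x)
  have hterm (s : S) : α (N.terminal s) = 0 ∧
      (σ (N.terminal s)).1 s + (σ (N.terminal s)).2 s = 0 := by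
    have h₁ : 0 ≤ (σ (N.terminal s)).1 s := (hR (hσ _)).2.1 s
    have h₂ : 0 ≤ (σ (N.terminal s)).2 s := (hR (hσ _)).2.2 s
    obtain ⟨h₃, h₄⟩ := hσρ (N.terminal s) s
    obtain ⟨h₅, h₆⟩ := hρs s
    constructor <;> linarith
  have hD (e : E) : D (σ (N.tail e)) (σ (N.head e)) ≤ l e + (α (N.head e) - α (N.tail e)) := by
    obtain ⟨h₁, h₂⟩ := (D_le_iff (hl e)).1 (hρe e)
    refine hbal.D_le (hσ _) (hσ _) (fun s => ?_) fun s => ?_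
    · linarith [h₁ s, (hσρ (N.head e) s).1, (hσρ (N.tail e) s).1]
    · linarith [h₂ s, (hσρ (N.head e) s).2, (hσρ (N.tail e) s).2]
  refine strongDuality_of_flpCost_le hR (ρ := σ) (f := f) ⟨hσ, fun s => ⟨hσ _, (hterm s).2⟩⟩ ?_
  calc N.flpCost σ ≤ ∑ e, (N.cap e : ℝ) * (l e + (α (N.head e) - α (N.tail e))) :=
        Finset.sum_le_sum fun e _ => mul_le_mul_of_nonneg_left (hD e) (Nat.cast_nonneg _)
    _ = f.val μ := by
        simp only [hfl, mul_add, Finset.sum_add_distrib,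
          hN.sum_cap_mul_sub_eq_zero fun s => (hterm s).1, add_zero]

end Network

theorem eq_T_of_isEmpty {S : Type*} [IsEmpty S] {μ : S → S → ℝ} {R : Set (Pt S)}
    (hsurj : Set.SurjOn (lineality S).mkQ R (Qbar μ)) : R = T μ := by
  have hQ : tightPoint ⊥ μ 0 ∈ Q μ :=
    minimal_mem_floorPart_bot_iff.1 (minimal_tightPoint fun _ => bot_le)
  have hT : tightPoint 0 μ 0 ∈ T μ :=
    minimal_mem_floorPart_zero_iff.1 (minimal_tightPoint fun _ => le_rfl)
  obtain ⟨-, q, hq, -⟩ := exists_mem_eq_add_of_surjOn hsurj hQ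
  rw [Set.Nonempty.eq_univ ⟨q, hq⟩, Set.Nonempty.eq_univ ⟨_, hT⟩]

theorem mainTheorem1_general {S : Type u} [Fintype S] (μ : S → S → ℝ) (hμ : ∀ s, μ s s ≤ 0) :
    (∀ (V : Type v) (E : Type w) [Fintype E] (N : Network S V E), N.StrongDuality μ (T μ)) ∧
    (∀ R : Set (Pt S), R ⊆ nonnegPart (P μ) → Set.SurjOn (lineality S).mkQ R (Qbar μ) →
        IsBalanced R → ∀ (V : Type v) (E : Type w) [Fintype E] (N : Network S V E),
          N.InnerEulerian → N.StrongDuality μ R) := by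
  refine ⟨fun V E _ N => N.strongDuality_T hμ, fun R hR hsurj hbal V E _ N hN => ?_⟩
  rcases isEmpty_or_nonempty S with hS | hS
  · exact eq_T_of_isEmpty hsurj ▸ N.strongDuality_T hμ
  · exact hN.strongDuality_of_isBalanced hμ hR hsurj hbal

end DirectedMultiflow

theorem mainTheorem1 {S : Type u} [Fintype S] (μ : S → S → ℝ)
    (hμ : DirectedMultiflow.IsDirectedDistance μ) :
    (∀ (V : Type v) (E : Type w) [Fintype V] [Fintype E]
        (N : DirectedMultiflow.Network S V E),
        N.StrongDuality μ (DirectedMultiflow.T μ)) ∧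
    (∀ R : Set (DirectedMultiflow.Pt S),
        R ⊆ DirectedMultiflow.nonnegPart (DirectedMultiflow.Q μ) →
        DirectedMultiflow.IsSection μ R → DirectedMultiflow.IsBalanced R →
        ∀ (V : Type v) (E : Type w) [Fintype V] [Fintype E]
          (N : DirectedMultiflow.Network S V E), N.InnerEulerian →
          N.StrongDuality μ R) :=
  have h := DirectedMultiflow.mainTheorem1_general.{u, v, w} μ fun s => (hμ.diag s).le
  ⟨fun V E _ _ N => h.1 V E N, fun R hR hsec hbal V E _ _ N hN =>
    h.2 R (fun _ hp => ⟨(hR hp).1.1, (hR hp).2⟩) hsec.2.surjOn hbal V E N hN⟩
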